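/- Fix $n\ge 1$ and write $[n]=\{1,\dots,n\}$. **Schubert matroids.** For $R,S\subseteq[n]$ write $R\le S$ if $\#R=\#S$ and, for every $m$, the $m$-th smallest element of $R$ is at most the $m$-th smallest element of $S$. For $I\subseteq[n]$ the Schubert matroid $\mathrm{SM}_n(I)$ is the matroid on $[n]$ whose bases are the sets $B\subseteq[n]$ with $B\le I$, and its rank function is $r_{\mathrm{SM}_n(I)}(J)=\max\{\#(J\cap B): B\le I\}$. **Schubitopes.** A diagram $D\subseteq[n]\times[k]$ (with $k\ge 0$ columns) is written as its list of columns $D=(D_1,\dots,D_k)$, $D_j\subseteq[n]$; for diagrams with the same number of columns, $C\le D$ means $C_j\le D_j$ for all $j$. Let $Y$ be the generic upper triangular $n\times n$ matrix with entries $y_{ij}$ for $i\le j$ and $0$ elsewhere, and let $\mathcal M_D\subseteq\mathbb C[y_{ij}:i\le j]$ be the span of the products $\prod_{j=1}^k\det(Y^{C_j}_{D_j})$ over all $C\le D$, where $Y_{D_j}^{C_j}$ is the submatrix with rows $C_j$ and columns $D_j$. An invertible upper triangular matrix $b$ acts on polynomials by $f(Y)\cdot b=f(b^{-1}Y)$.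 The dual character $\chi_D(x_1,\dots,x_n)$ is the trace of $\mathrm{diag}(x_1^{-1},\dots,x_n^{-1})$ acting on $\mathcal M_D$; it is a polynomial in $\mathbb Z[x_1,\dots,x_n]$. The Schubitope $\mathcal S_D\subset\mathbb R^n$ is the Newton polytope of $\chi_D$ (the convex hull of the exponent vectors of $\chi_D$). **Generalized permutahedra.** A function $z:2^{[n]}\to\mathbb R$ is submodular if $z(I)+z(J)\ge z(I\cup J)+z(I\cap J)$ for all $I,J\subseteq[n]$. A generalized permutahedron with associated submodular function $z$, where $z$ is submodular and $z(\emptyset)=0$, is the polytope $$P=\Big\{t\in\mathbb R^n:\ \sum_{i\in I}t_i\le z(I)\text{ for all }I\subseteq[n],\ \sum_{i=1}^n t_i=z([n])\Big\}.$$ **Theorem.** 1. The rank functions $r_{\mathrm{SM}_n(I)}$, indexed by the nonempty subsets $I\subseteq[n]$, form a basis of the real vector space of functions $f:2^{[n]}\to\mathbb R$ with $f(\emptyset)=0$. 2. Let $P\subset\mathbb R^n$ be a generalized permutahedron with associated submodular function $z$. Then $P$ is a Schubitope (that is, $P=\mathcal S_D$ for some $k$ and some diagram $D\subseteq[n]\times[k]$)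 if and only if $z$ is a linear combination of the functions $r_{\mathrm{SM}_n(I)}$, $\emptyset\ne I\subseteq[n]$, with coefficients in $\mathbb Z_{\ge0}$. 3. For diagrams $D,D'\subseteq[n]\times[k]$, $\mathcal S_D=\mathcal S_{D'}$ if and only if $D$ is obtained from $D'$ by a permutation of the columns. More generally, for $D\subseteq[n]\times[k]$ and $D'\subseteq[n]\times[k']$, $\mathcal S_D=\mathcal S_{D'}$ if and only if the nonempty columns of $D$ are, up to a permutation, the nonempty columns of $D'$. -/

import Mathlib

namespace SchubitopeTheory

/-! ### Diagrams -/

/-- A diagram `D ⊆ [n] × [k]`, recorded by its columns `D = (D_1, …, D_k)`, each a subset of `[n]`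
(the index set `Fin n` stands for `[n]`, in the same order). -/
abbrev Diagram (n k : ℕ) : Type := Fin k → Finset (Fin n)

/-- `R ≤ S`: the two sets have the same size, and the `m`-th smallest element of `R` does not
exceed the `m`-th smallest element of `S`, for every `m`. -/
def SetLE {n : ℕ} (R S : Finset (Fin n)) : Prop :=
  ∃ h : R.card = S.card, ∀ m : Fin S.card, R.orderEmbOfFin h m ≤ S.orderEmbOfFin rfl m

/-- `C ≤ D` for diagrams: columnwise comparison. -/
def DiagramLE {n k : ℕ} (C D : Diagram n k) : Prop :=
  ∀ j, SetLE (C j) (D j)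

/-! ### Flagged Weyl modules and their dual characters -/

/-- The coordinate ring `ℂ[𝔟]` of the space `𝔟` of upper triangular `n × n` matrices: the polynomial
ring in the variables `y_{ij}`, `i ≤ j`. -/
abbrev BorelRing (n : ℕ) : Type := MvPolynomial {p : Fin n × Fin n // p.1 ≤ p.2} ℂ

/-- The generic upper triangular matrix `Y`. -/
noncomputable def genericUpper (n : ℕ) : Matrix (Fin n) (Fin n) (BorelRing n) :=
  fun i j => if h : i ≤ j then MvPolynomial.X ⟨(i, j), h⟩ else 0

/-- The action `f(Y) · b = f(b⁻¹ Y)` on `ℂ[𝔟]`, for `b` invertible and upper triangular. -/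
noncomputable def borelAct {n : ℕ} (b : GL (Fin n) ℂ) : BorelRing n →ₐ[ℂ] BorelRing n :=
  MvPolynomial.aeval fun p =>
    ((((b⁻¹ : GL (Fin n) ℂ) : Matrix (Fin n) (Fin n) ℂ).map MvPolynomial.C * genericUpper n :
      Matrix (Fin n) (Fin n) (BorelRing n))) p.1.1 p.1.2

/-- The minor `det (Y_R^S)` of the generic upper triangular matrix with column set `R` and
row set `S`, both listed increasingly. -/
noncomputable def upperMinor {n : ℕ} (R S : Finset (Fin n)) (h : S.card = R.card) : BorelRing n :=
  ((genericUpper n).submatrix (S.orderEmbOfFin h) (R.orderEmbOfFin rfl)).det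

/-- The product of minors `∏_j det (Y_{D_j}^{C_j})`, for `C ≤ D`. -/
noncomputable def minorProduct {n k : ℕ} (C D : Diagram n k) (h : DiagramLE C D) : BorelRing n :=
  ∏ j, upperMinor (D j) (C j) (h j).fst

/-- The flagged Weyl module `M_D ⊆ ℂ[𝔟]`. -/
noncomputable def flaggedWeylModule {n k : ℕ} (D : Diagram n k) : Submodule ℂ (BorelRing n) :=
  Submodule.span ℂ {f | ∃ (C : Diagram n k) (h : DiagramLE C D), f = minorProduct C D h}

/-- The diagonal matrix `diag(x_1, …, x_n)` of the torus `T`. -/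
def torusElt {n : ℕ} (x : Fin n → ℂˣ) : GL (Fin n) ℂ where
  val := Matrix.diagonal fun i => (x i : ℂ)
  inv := Matrix.diagonal fun i => ((x i)⁻¹ : ℂˣ)
  val_inv := by simp
  inv_val := by simp

theorem genericUpper_act {n : ℕ} (x : Fin n → ℂˣ) (i j : Fin n) :
    borelAct (torusElt x⁻¹) (genericUpper n i j) =
      MvPolynomial.C (x i : ℂ) * genericUpper n i j := by
  have hinv : (((torusElt x⁻¹)⁻¹ : GL (Fin n) ℂ) : Matrix (Fin n) (Fin n) ℂ) =
      Matrix.diagonal fun i => (x i : ℂ) := by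
    change Matrix.diagonal (fun i => (((x⁻¹ : Fin n → ℂˣ) i)⁻¹ : ℂˣ).val) = _
    simp
  by_cases h : i ≤ j
  · have : genericUpper n i j = MvPolynomial.X ⟨(i, j), h⟩ := by simp [genericUpper, h]
    rw [this, borelAct, MvPolynomial.aeval_X, hinv, Matrix.diagonal_map (by simp),
      Matrix.diagonal_mul, this]
  · simp [genericUpper, h]

theorem upperMinor_act {n : ℕ} (x : Fin n → ℂˣ) (R S : Finset (Fin n)) (h : S.card = R.card) :
    borelAct (torusElt x⁻¹) (upperMinor R S h) =
      MvPolynomial.C (∏ i ∈ S, (x i : ℂ)) * upperMinor R S h := by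
  have hprod : ∏ i ∈ S, (x i : ℂ) = ∏ m, (x (S.orderEmbOfFin h m) : ℂ) := by
    conv_lhs => rw [← Finset.map_orderEmbOfFin_univ S h]
    rw [Finset.prod_map]
    rfl
  rw [upperMinor, AlgHom.map_det, hprod, map_prod, ← Matrix.det_mul_column]
  congr 1
  ext a b : 2
  simp [genericUpper_act]

theorem minorProduct_act {n k : ℕ} (x : Fin n → ℂˣ) (C D : Diagram n k) (h : DiagramLE C D) :
    borelAct (torusElt x⁻¹) (minorProduct C D h) =
      (∏ j, ∏ i ∈ C j, (x i : ℂ)) • minorProduct C D h := by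
  rw [minorProduct, map_prod, MvPolynomial.smul_eq_C_mul, map_prod, ← Finset.prod_mul_distrib]
  exact Finset.prod_congr rfl fun j _ => upperMinor_act x _ _ _

/-- The flagged Weyl module is stable under the torus. -/
theorem flaggedWeylModule_stable {n k : ℕ} (D : Diagram n k) (x : Fin n → ℂˣ) :
    ∀ f ∈ flaggedWeylModule D,
      (borelAct (torusElt x⁻¹)).toLinearMap f ∈ flaggedWeylModule D := by
  intro f hf
  induction hf using Submodule.span_induction with
  | mem f hf =>
    obtain ⟨C, h, rfl⟩ := hf
    rw [AlgHom.toLinearMap_apply, minorProduct_act]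
    exact Submodule.smul_mem _ _ (Submodule.subset_span ⟨C, h, rfl⟩)
  | zero => simp
  | add f g _ _ hf hg => rw [map_add]; exact Submodule.add_mem _ hf hg
  | smul c f _ hf => rw [map_smul]; exact Submodule.smul_mem _ _ hf

/-- The dual character `χ_D` of the flagged Weyl module, a function on the torus: its value at
`diag(x_1, …, x_n)` is the trace of `diag(x_1⁻¹, …, x_n⁻¹)` acting on `M_D`. -/
noncomputable def dualCharacter {n k : ℕ} (D : Diagram n k) (x : Fin n → ℂˣ) : ℂ :=
  LinearMap.trace ℂ (flaggedWeylModule D)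
    ((borelAct (torusElt x⁻¹)).toLinearMap.restrict (flaggedWeylModule_stable D x))

/-- The dual character is given by a polynomial with integer coefficients. -/
theorem exists_dualCharacter_eq {n k : ℕ} (D : Diagram n k) :
    ∃ p : MvPolynomial (Fin n) ℤ, ∀ x : Fin n → ℂˣ,
      MvPolynomial.aeval (fun i => (x i : ℂ)) p = dualCharacter D x := by
  classical
  obtain ⟨b, hbs, hspan, hli⟩ := exists_linearIndependent ℂ
    {f | ∃ (C : Diagram n k) (h : DiagramLE C D), f = minorProduct C D h}
  have hfin : b.Finite := by
    refine Set.Finite.subset ?_ hbs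
    refine (Set.finite_range fun C : Diagram n k =>
      if h : DiagramLE C D then minorProduct C D h else 0).subset ?_
    rintro f ⟨C, h, rfl⟩
    exact ⟨C, by simp [h]⟩
  have : Fintype b := hfin.fintype
  choose C hC hCeq using hbs
  let B : Module.Basis b ℂ (flaggedWeylModule D) :=
    (Module.Basis.span hli).map
      (LinearEquiv.ofEq _ _ (by rw [Subtype.range_coe]; exact hspan))
  have hB : ∀ v : b, ((B v : flaggedWeylModule D) : BorelRing n) = v := by
    intro v
    simp [B, Module.Basis.span_apply]
  refine ⟨∑ v : b, ∏ j, ∏ i ∈ C v.2 j, MvPolynomial.X i, fun x => ?_⟩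
  rw [dualCharacter, LinearMap.trace_eq_matrix_trace ℂ B, Matrix.trace, map_sum]
  refine Finset.sum_congr rfl fun v _ => ?_
  have hact : (borelAct (torusElt x⁻¹)).toLinearMap.restrict (flaggedWeylModule_stable D x) (B v) =
      (∏ j, ∏ i ∈ C v.2 j, (x i : ℂ)) • B v := by
    apply Subtype.ext
    rw [Submodule.coe_smul, hB]
    change borelAct _ ((B v : flaggedWeylModule D) : BorelRing n) = _
    rw [hB]
    have h1 := minorProduct_act x (C v.2) D (hC v.2)
    rwa [← hCeq v.2] at h1
  rw [Matrix.diag_apply, LinearMap.toMatrix_apply, hact]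
  simp

/-- The polynomial `χ_D`. -/
noncomputable def dualCharacterPoly {n k : ℕ} (D : Diagram n k) : MvPolynomial (Fin n) ℤ :=
  Classical.choose (exists_dualCharacter_eq D)

theorem dualCharacterPoly_unique {n k : ℕ} (D : Diagram n k) (p : MvPolynomial (Fin n) ℤ)
    (hp : ∀ x : Fin n → ℂˣ, MvPolynomial.aeval (fun i => (x i : ℂ)) p = dualCharacter D x) :
    p = dualCharacterPoly D := by
  apply MvPolynomial.map_injective (Int.castRingHom ℂ) Int.cast_injective
  refine MvPolynomial.funext_set (fun _ => {0}ᶜ) (fun _ => (Set.finite_singleton 0).infinite_compl)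
    fun x hx => ?_
  have hx0 : ∀ i, x i ≠ 0 := fun i => hx i trivial
  have h1 := (hp fun i => Units.mk0 (x i) (hx0 i)).trans
    (Classical.choose_spec (exists_dualCharacter_eq D) fun i => Units.mk0 (x i) (hx0 i)).symm
  rw [MvPolynomial.eval_map, MvPolynomial.eval_map]
  exact h1

/-- The Newton polytope of a polynomial: the convex hull in `ℝⁿ` of its exponent vectors. -/
def newtonPolytope {n : ℕ} (p : MvPolynomial (Fin n) ℤ) : Set (Fin n → ℝ) :=
  convexHull ℝ ((fun (α : Fin n →₀ ℕ) (i : Fin n) => (α i : ℝ)) '' (p.support : Set (Fin n →₀ ℕ)))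

/-- The Schubitope of a diagram: the Newton polytope of its dual character. -/
noncomputable def schubitope {n k : ℕ} (D : Diagram n k) : Set (Fin n → ℝ) :=
  newtonPolytope (dualCharacterPoly D)

/-- A subset of `ℝⁿ` is a Schubitope if it is the Schubitope of a diagram `D ⊆ [n] × [k]`, for
some number `k` of columns. -/
def IsSchubitope {n : ℕ} (P : Set (Fin n → ℝ)) : Prop :=
  ∃ (k : ℕ) (D : Diagram n k), P = schubitope D

/-! ### Generalized permutahedra -/

/-- Submodularity of a set function `z : 2^[n] → ℝ`. -/
def IsSubmodular {n : ℕ} (z : Finset (Fin n) → ℝ) : Prop :=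
  ∀ I J, z (I ∪ J) + z (I ∩ J) ≤ z I + z J

/-- `P` is the generalized permutahedron whose associated submodular function is `z`. -/
def IsGeneralizedPermutahedronOf {n : ℕ} (P : Set (Fin n → ℝ)) (z : Finset (Fin n) → ℝ) : Prop :=
  IsSubmodular z ∧ z ∅ = 0 ∧
    P = {t | (∀ I : Finset (Fin n), ∑ i ∈ I, t i ≤ z I) ∧ ∑ i, t i = z Finset.univ}

/-! ### Schubert matroids -/

theorem setLE_iff {n : ℕ} (R S : Finset (Fin n)) :
    SetLE R S ↔ R.card = S.card ∧
      ∀ t, (R.filter (t ≤ ·)).card ≤ (S.filter (t ≤ ·)).card := by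
  have key : ∀ (A : Finset (Fin n)) (m : ℕ) (h : A.card = m) (t : Fin n),
      (A.filter (t ≤ ·)).card =
        (Finset.univ.filter fun i : Fin m => t ≤ A.orderEmbOfFin h i).card := by
    intro A m h t
    conv_lhs => rw [← Finset.map_orderEmbOfFin_univ A h]
    rw [Finset.filter_map, Finset.card_map]
    rfl
  constructor
  · rintro ⟨h, hle⟩
    refine ⟨h, fun t => ?_⟩
    rw [key R _ h, key S _ rfl]
    refine Finset.card_le_card fun i hi => ?_
    simp only [Finset.mem_filter, Finset.mem_univ, true_and] at hi ⊢
    exact hi.trans (hle i)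
  · rintro ⟨h, hle⟩
    refine ⟨h, fun m => ?_⟩
    by_contra! hlt
    have h1 := hle (R.orderEmbOfFin h m)
    rw [key R _ h, key S _ rfl] at h1
    refine absurd h1 (not_le.2 (Finset.card_lt_card ?_))
    refine Finset.ssubset_iff_subset_ne.2 ⟨fun i hi => ?_, fun he => ?_⟩
    · simp only [Finset.mem_filter, Finset.mem_univ, true_and, OrderEmbedding.le_iff_le] at hi ⊢
      have h2 := hlt.trans_le hi
      exact ((OrderEmbedding.lt_iff_lt _).1 h2).le
    · have hm : m ∈ Finset.univ.filter
          (fun i => R.orderEmbOfFin h m ≤ R.orderEmbOfFin h i) := by simp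
      rw [← he] at hm
      simp only [Finset.mem_filter, Finset.mem_univ, true_and] at hm
      exact absurd hm (not_le.2 hlt)

theorem setLE_exchange {n : ℕ} {I X Y : Finset (Fin n)} (hX : SetLE X I) (hY : SetLE Y I)
    {a : Fin n} (haX : a ∈ X) (haY : a ∉ Y) :
    ∃ b, b ∈ Y ∧ b ∉ X ∧ SetLE (insert b (X.erase a)) I := by
  rw [setLE_iff] at hX hY
  have hcard : X.card = Y.card := hX.1.trans hY.1.symm
  have hne : (Y \ X).Nonempty := by
    rw [Finset.nonempty_iff_ne_empty, Ne, Finset.sdiff_eq_empty_iff_subset]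
    intro hYX
    exact haY (Finset.eq_of_subset_of_card_le hYX hcard.le ▸ haX)
  obtain ⟨b, hb, hmin⟩ := (Y \ X).exists_min_image id hne
  rw [Finset.mem_sdiff] at hb
  refine ⟨b, hb.1, hb.2, ?_⟩
  have hbe : b ∉ X.erase a := fun h => hb.2 (Finset.mem_of_mem_erase h)
  have hpos : 0 < X.card := Finset.card_pos.2 ⟨a, haX⟩
  rw [setLE_iff]
  refine ⟨by rw [Finset.card_insert_of_notMem hbe, Finset.card_erase_of_mem haX]; omega,
    fun t => ?_⟩
  rw [Finset.filter_insert, Finset.filter_erase]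
  have hbe' : b ∉ (X.filter (t ≤ ·)).erase a := fun h =>
    hb.2 (Finset.mem_filter.1 (Finset.mem_of_mem_erase h)).1
  split_ifs with htb
  · rw [Finset.card_insert_of_notMem hbe']
    by_cases hta : t ≤ a
    · have hmem : a ∈ X.filter (t ≤ ·) := Finset.mem_filter.2 ⟨haX, hta⟩
      rw [Finset.card_erase_add_one hmem]
      exact hX.2 t
    · have hsub : Y.filter (fun i => ¬ t ≤ i) ⊂ X.filter (fun i => ¬ t ≤ i) := by
        rw [Finset.ssubset_iff_of_subset]
        · exact ⟨a, by simp [haX, not_le.1 hta], by simp [haY]⟩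
        · intro y hy
          rw [Finset.mem_filter] at hy ⊢
          refine ⟨?_, hy.2⟩
          by_contra hyX
          exact hy.2 (htb.trans (hmin y (Finset.mem_sdiff.2 ⟨hy.1, hyX⟩)))
      have h1 := Finset.card_lt_card hsub
      have h2 := X.card_filter_add_card_filter_not (t ≤ ·)
      have h3 := Y.card_filter_add_card_filter_not (t ≤ ·)
      have h4 := hY.2 t
      have h5 := Finset.card_erase_le (s := X.filter (t ≤ ·)) (a := a)
      omega
  · exact Finset.card_erase_le.trans (hX.2 t)

/-- The Schubert matroid `SM_n(I)`, `I = {s_1 < … < s_r}`: its ground set is `[n]` and its bases are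
the sets `{a_1 < … < a_r}` with `a_1 ≤ s_1, …, a_r ≤ s_r`. -/
noncomputable def schubertMatroid (n : ℕ) (I : Finset (Fin n)) : Matroid (Fin n) :=
  Matroid.ofIsBaseOfFinite (E := Set.univ) Set.finite_univ
    (fun B => ∃ A : Finset (Fin n), (A : Set (Fin n)) = B ∧ SetLE A I)
    ⟨I, I, rfl, rfl, fun _ => le_rfl⟩
    (by
      rintro _ _ ⟨X, rfl, hX⟩ ⟨Y, rfl, hY⟩ a ⟨haX, haY⟩
      obtain ⟨b, hbY, hbX, hb⟩ := setLE_exchange hX hY haX haY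
      exact ⟨b, ⟨hbY, hbX⟩, _, by simp, hb⟩)
    (fun _ _ => Set.subset_univ _)

open Classical in
/-- The rank function of a matroid on `[n]`: `r_M(S) = max {#(S ∩ B) : B a basis of M}`. -/
noncomputable def matroidRank {n : ℕ} (M : Matroid (Fin n)) (S : Finset (Fin n)) : ℕ :=
  (Finset.univ.filter fun B : Finset (Fin n) => M.IsBase (B : Set (Fin n))).sup
    fun B => (S ∩ B).card

/-- `matroidRank` agrees with the usual rank of a set in a matroid. -/
theorem matroidRank_eq_eRk {n : ℕ} (M : Matroid (Fin n)) (S : Finset (Fin n)) (hM : M.E = Set.univ) :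
    (matroidRank M S : ℕ∞) = M.eRk S := by
  classical
  apply le_antisymm
  · rw [matroidRank]
    obtain ⟨B₀, hB₀⟩ := M.exists_isBase
    obtain ⟨B, hB, hsup⟩ := Finset.exists_mem_eq_sup
      (Finset.univ.filter fun B : Finset (Fin n) => M.IsBase (B : Set (Fin n)))
      ⟨B₀.toFinset, by simpa using hB₀⟩ (fun B => (S ∩ B).card)
    have hB' : M.IsBase (B : Set (Fin n)) := by simpa using hB
    have hind : M.Indep ((S ∩ B : Finset (Fin n)) : Set (Fin n)) :=
      hB'.indep.subset (by simp)
    have := hind.encard_le_eRk_of_subset (X := (S : Set (Fin n))) (by simp)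
    rw [Set.encard_coe_eq_coe_finsetCard] at this
    refine le_trans (le_of_eq ?_) this
    rw [← hsup]
  · obtain ⟨J, hJ⟩ := M.exists_isBasis (S : Set (Fin n)) (by simp [hM])
    obtain ⟨B, hB, hJB⟩ := hJ.indep.exists_isBase_superset
    rw [← hJ.encard_eq_eRk]
    have h1 : J ⊆ ((S ∩ B.toFinset : Finset (Fin n)) : Set (Fin n)) := by
      simpa using ⟨hJ.subset, hJB⟩
    refine (Set.encard_le_encard h1).trans ?_
    rw [Set.encard_coe_eq_coe_finsetCard, Nat.cast_le, matroidRank]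
    exact Finset.le_sup (f := fun B => (S ∩ B).card) (by simpa using hB)

/-- The rank function of the Schubert matroid `SM_n(I)`, as a function `2^[n] → ℝ`. -/
noncomputable def schubertRank {n : ℕ} (I : Finset (Fin n)) : Finset (Fin n) → ℝ :=
  fun J => (matroidRank (schubertMatroid n I) J : ℝ)

/-- The space of functions `f : 2^[n] → ℝ` with `f(∅) = 0`. -/
def pointedSetFunctions (n : ℕ) : Submodule ℝ (Finset (Fin n) → ℝ) where
  carrier := {f | f ∅ = 0}
  add_mem' := by
    intro f g hf hg
    simp_all
  zero_mem' := rfl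
  smul_mem' := by
    intro c f hf
    simp_all

end SchubitopeTheory

open SchubitopeTheory

/-!
The dual character `χ_D` has the exponents `rowWeight C`, `C ≤ D`: minor products are weight vectors
for the torus, none of them vanishes, and distinct weight spaces are independent. The columns `C_j`
run independently through the bases of the Schubert matroids of the `D_j`. A greedy argument, which
finds one base meeting every member of a chain of sets in a maximal independent subset, shows that
the convex hull of these exponents is the generalized permutahedron of the sum of the Schubert rank
functions of the columns: for each weight, the superlevel sets form such a chain. A generalized
permutahedron attains each of its defining inequalities, hence determines its submodular function,
and everything reduces to the linear independence of the functions `r_{SM_n(I)}`, `I ≠ ∅`. For this,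
let `m = max J` and `K = (J \ {m}) ∪ (m, n]`. If `m` increases the rank of `K` in `SM_n(I)`, then
some base `B ≤ I` contains `J`; so the functionals `f ↦ f(K ∪ {m}) - f(K)` are triangular for the
order that compares the numbers `#(I ∩ [t, n])`.
-/

namespace SchubitopeTheory

section LinearIndependence

variable {ι κ κ' R M P : Type*}

theorem linearIndependent_of_triangular [CommRing R] [NoZeroDivisors R] [AddCommGroup M]
    [Module R M] [PartialOrder P] {v : ι → M} (φ : ι → Module.Dual R M) {p : ι → P}
    (hp : p.Injective) (hdiag : ∀ i, φ i (v i) ≠ 0) (htri : ∀ i j, φ j (v i) ≠ 0 → p j ≤ p i) :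
    LinearIndependent R v := by
  classical
  rw [linearIndependent_iff']
  intro s c hc
  by_contra! hne
  obtain ⟨j, hj, hmax⟩ := (s.filter (c · ≠ 0)).exists_maximalFor p
    (by simpa [Finset.Nonempty] using hne)
  obtain ⟨hjs, hcj⟩ := Finset.mem_filter.1 hj
  have hoff : ∀ i ∈ s, i ≠ j → c i * φ j (v i) = 0 := by
    intro i his hij
    by_contra h
    obtain ⟨hci, hi⟩ := mul_ne_zero_iff.1 h
    have hji := htri i j hi
    exact hij (hp ((hmax (Finset.mem_filter.2 ⟨his, hci⟩) hji).antisymm hji))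
  have hsum : ∑ i ∈ s, c i * φ j (v i) = 0 := by
    simpa only [map_sum, map_smul, smul_eq_mul, map_zero] using congrArg (φ j) hc
  rw [Finset.sum_eq_single_of_mem j hjs hoff] at hsum
  exact mul_ne_zero hcj (hdiag j) hsum

theorem sum_comp_eq_sum_comp_iff_exists_equiv [Semiring R] [CharZero R] [AddCommMonoid M]
    [Module R M] [Fintype κ] [Fintype κ'] {v : ι → M} (hv : LinearIndependent R v) (f : κ → ι)
    (g : κ' → ι) :
    ∑ j, v (f j) = ∑ j, v (g j) ↔ ∃ e : κ ≃ κ', ∀ j, f j = g (e j) := by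
  classical
  constructor
  · intro h
    have hcard : ∀ i, Fintype.card {j // f j = i} = Fintype.card {j // g j = i} := by
      intro i
      have hcomb : Finsupp.linearCombination R v (∑ j, Finsupp.single (f j) 1) =
          Finsupp.linearCombination R v (∑ j, Finsupp.single (g j) 1) := by
        simpa only [map_sum, Finsupp.linearCombination_single, one_smul] using h
      have hi := DFunLike.congr_fun (hv hcomb) i
      simp only [Finsupp.finsetSum_apply, Finsupp.single_apply, Finset.sum_boole,
        Nat.cast_inj] at hi
      rwa [Fintype.card_subtype, Fintype.card_subtype]
    exact ⟨Equiv.ofFiberEquiv fun i => Fintype.equivOfCardEq (hcard i),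
      fun j => (Equiv.ofFiberEquiv_map _ j).symm⟩
  · rintro ⟨e, he⟩
    simp only [he, e.sum_comp fun j => v (g j)]

end LinearIndependence

section BasePolytope

variable {α : Type*} [Fintype α]

/-- The base polytope of a set function `z`. When `z` is submodular and vanishes at `∅`, this is the
generalized permutahedron associated with `z`. -/
def basePolytope (z : Finset α → ℝ) : Set (α → ℝ) :=
  {t | (∀ I : Finset α, ∑ i ∈ I, t i ≤ z I) ∧ ∑ i, t i = z Finset.univ}

theorem convex_basePolytope (z : Finset α → ℝ) : Convex ℝ (basePolytope z) := by
  have hlin : ∀ I : Finset α, IsLinearMap ℝ fun t : α → ℝ => ∑ i ∈ I, t i := fun I =>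
    ⟨fun s t => by simp [Finset.sum_add_distrib], fun c t => by simp [Finset.mul_sum]⟩
  rw [basePolytope, Set.ofPred_and, Set.ofPred_forall]
  exact (convex_iInter fun I => convex_halfSpace_le (hlin I) _).inter
    (convex_hyperplane (hlin Finset.univ) _)

theorem sum_mul_nonneg_of_superlevel {w d : α → ℝ} (hlevel : ∀ c, 0 ≤ ∑ i with c ≤ w i, d i)
    (htotal : ∑ i, d i = 0) : 0 ≤ ∑ i, w i * d i := by
  obtain ⟨m, hm⟩ := (Set.finite_range w).bddBelow
  obtain ⟨b, hb⟩ := ((Set.finite_range w).insert m).bddAbove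
  have hmb : m ≤ b := hb (Set.mem_insert m _)
  have hw : ∀ i, w i ∈ Set.Icc m b := fun i => ⟨hm ⟨i, rfl⟩, hb (Or.inr ⟨i, rfl⟩)⟩
  -- layer cake: `w i - m` is the integral over `c ∈ [m, b]` of the indicator of `c ≤ w i`
  calc 0 ≤ ∫ c in m..b, ∑ i, {c | c ≤ w i}.indicator (fun _ => d i) c := by
        refine intervalIntegral.integral_nonneg_of_forall hmb fun c => ?_
        simpa only [Finset.sum_filter, Set.indicator_apply, Set.mem_ofPred_eq] using hlevel c
    _ = ∑ i, ∫ c in m..b, {c | c ≤ w i}.indicator (fun _ => d i) c :=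
        intervalIntegral.integral_finsetSum fun i _ => by
          rw [intervalIntegrable_iff]
          exact (MeasureTheory.integrableOn_const (by simp)).indicator measurableSet_Iic
    _ = ∑ i, (w i - m) * d i := Finset.sum_congr rfl fun i _ => by
        rw [intervalIntegral.integral_indicator (hw i), intervalIntegral.integral_const,
          smul_eq_mul]
    _ = ∑ i, w i * d i := by
        simp only [sub_mul, Finset.sum_sub_distrib, ← Finset.mul_sum, htotal, mul_zero, sub_zero]

theorem mem_convexHull_of_forall_exists_sum_mul_le {S : Set (α → ℝ)} (hS : S.Finite) {t : α → ℝ}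
    (h : ∀ w : α → ℝ, ∃ y ∈ S, ∑ i, w i * t i ≤ ∑ i, w i * y i) : t ∈ convexHull ℝ S := by
  classical
  by_contra ht
  obtain ⟨f, u, hfS, hft⟩ := geometric_hahn_banach_closed_point (convex_convexHull ℝ S)
    (hS.isClosed_convexHull ℝ) ht
  have hf : ∀ x : α → ℝ, f x = ∑ i, f (Pi.single i 1) * x i := by
    intro x
    conv_lhs => rw [pi_eq_sum_univ' x, map_sum]
    simp only [map_smul, smul_eq_mul, mul_comm]
  obtain ⟨y, hyS, hty⟩ := h fun i => f (Pi.single i 1)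
  rw [← hf, ← hf] at hty
  exact (hty.trans_lt (hfS y (subset_convexHull ℝ S hyS))).not_gt hft

end BasePolytope

section Matroid

variable {α κ : Type*} {M : Matroid α}

theorem exists_isBase_forall_isBasis'_inter [Finite α] (M : Matroid α) {𝒞 : Set (Set α)}
    (h𝒞 : IsChain (· ⊆ ·) 𝒞) : ∃ B, M.IsBase B ∧ ∀ X ∈ 𝒞, M.IsBasis' (B ∩ X) X := by
  classical
  obtain ⟨s, rfl⟩ := 𝒞.toFinite.exists_finset_coe
  suffices ∃ I, M.Indep I ∧ ∀ X ∈ s, M.IsBasis' (I ∩ X) X by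
    obtain ⟨I, hI, hIs⟩ := this
    obtain ⟨B, hB, hIB⟩ := hI.exists_isBase_superset
    refine ⟨B, hB, fun X hX => ?_⟩
    rw [← (hIs X hX).eq_of_subset_indep (hB.indep.inter_right X)
      (Set.inter_subset_inter_left X hIB) Set.inter_subset_right]
    exact hIs X hX
  induction s using Finset.induction_on_max_value Set.ncard with
  | empty => exact ⟨∅, M.empty_indep, by simp⟩
  | insert Y s _ hY ih =>
    obtain ⟨I, hI, hIs⟩ := ih (h𝒞.mono (by simp))
    obtain ⟨K, hKY, hIK⟩ := (hI.inter_right Y).subset_isBasis'_of_subset Set.inter_subset_right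
    refine ⟨K, hKY.indep, fun X hX => ?_⟩
    rcases Finset.mem_insert.1 hX with rfl | hXs
    · rwa [Set.inter_eq_left.2 hKY.subset]
    · have hXY : X ⊆ Y := (h𝒞.total (by simpa using hX) (by simp)).elim id fun hYX =>
        (Set.eq_of_subset_of_ncard_le hYX (hY X hXs)).ge
      have hIX : I ∩ X ⊆ K ∩ X := fun x hx => ⟨hIK ⟨hx.1, hXY hx.2⟩, hx.2⟩
      rw [← (hIs X hXs).eq_of_subset_indep (hKY.indep.inter_right X) hIX Set.inter_subset_right]
      exact hIs X hXs

/-- The rank function of a matroid, as a real-valued function on the finite sets. -/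
noncomputable def rankFunction (M : Matroid α) (I : Finset α) : ℝ :=
  (M.eRk (I : Set α)).toNat

theorem rankFunction_eq_card {I B : Finset α} (hB : M.IsBasis' (B : Set α) I) :
    rankFunction M I = B.card := by
  rw [rankFunction, ← hB.encard_eq_eRk, Set.encard_coe_eq_coe_finsetCard, ENat.toNat_natCast]

theorem eRk_coe_finset_ne_top (M : Matroid α) (I : Finset α) : M.eRk (I : Set α) ≠ ⊤ :=
  (M.isRkFinite_of_finite I.finite_toSet).eRk_lt_top.ne

theorem card_le_rankFunction {I B : Finset α} (hB : M.Indep (B : Set α)) (hBI : B ⊆ I) :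
    (B.card : ℝ) ≤ rankFunction M I := by
  have h := hB.encard_le_eRk_of_subset (Finset.coe_subset.2 hBI)
  rw [Set.encard_coe_eq_coe_finsetCard] at h
  exact Nat.cast_le.2 (ENat.toNat_natCast _ ▸ ENat.toNat_le_toNat h (eRk_coe_finset_ne_top M I))

theorem rankFunction_mono (M : Matroid α) : Monotone (rankFunction M) := fun _ J h =>
  Nat.cast_le.2 (ENat.toNat_le_toNat (M.eRk_mono (Finset.coe_subset.2 h))
    (eRk_coe_finset_ne_top M J))

theorem exists_isBase_card_inter_eq_rankFunction [Finite α] [DecidableEq α] (M : Matroid α)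
    (I : Finset α) :
    ∃ B : Finset α, M.IsBase (B : Set α) ∧ ((I ∩ B).card : ℝ) = rankFunction M I := by
  obtain ⟨B, hB, hBI⟩ := exists_isBase_forall_isBasis'_inter M
    (IsChain.singleton (a := (I : Set α)) (r := (· ⊆ ·)))
  obtain ⟨B, rfl⟩ := B.toFinite.exists_finset_coe
  refine ⟨B, hB, (rankFunction_eq_card ?_).symm⟩
  rw [Finset.coe_inter, Set.inter_comm]
  exact hBI _ rfl

theorem rankFunction_empty (M : Matroid α) : rankFunction M ∅ = 0 := by
  simp [rankFunction]

theorem rankFunction_submodular [DecidableEq α] (M : Matroid α) (I J : Finset α) :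
    rankFunction M (I ∪ J) + rankFunction M (I ∩ J) ≤ rankFunction M I + rankFunction M J := by
  have htop := eRk_coe_finset_ne_top M
  have h := ENat.toNat_le_toNat (M.eRk_inter_add_eRk_union_le (I : Set α) J)
    (WithTop.add_ne_top.2 ⟨htop I, htop J⟩)
  rw [← Finset.coe_inter, ← Finset.coe_union, ENat.toNat_add (htop _) (htop _),
    ENat.toNat_add (htop _) (htop _)] at h
  rw [add_comm, rankFunction, rankFunction, rankFunction, rankFunction]
  exact_mod_cast h

variable [Fintype κ]

/-- The vector whose entry at `i` is the number of members of the family `C` that contain `i`. When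
`C` lists the columns of a diagram, this is the vector of its row sizes. -/
noncomputable def rowWeight (C : κ → Finset α) : α →₀ ℕ :=
  ∑ j, ∑ i ∈ C j, Finsupp.single i 1

theorem sum_rowWeight [DecidableEq α] (C : κ → Finset α) (I : Finset α) :
    ∑ i ∈ I, rowWeight C i = ∑ j, (I ∩ C j).card := by
  simp only [rowWeight, Finsupp.finsetSum_apply, Finsupp.single_apply]
  rw [Finset.sum_comm]
  refine Finset.sum_congr rfl fun j _ => ?_
  rw [Finset.sum_comm]
  simp [Finset.sum_ite_mem, Finset.inter_comm]

theorem rowWeight_mem_basePolytope [Fintype α] {M : κ → Matroid α} {C : κ → Finset α}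
    (hC : ∀ j, (M j).IsBase (C j : Set α)) :
    (fun i => (rowWeight C i : ℝ)) ∈ basePolytope (∑ j, rankFunction (M j)) := by
  classical
  constructor
  · intro I
    rw [← Nat.cast_sum, sum_rowWeight, Nat.cast_sum, Finset.sum_apply]
    exact Finset.sum_le_sum fun j _ => card_le_rankFunction
      ((hC j).indep.subset (Finset.coe_subset.2 Finset.inter_subset_right)) Finset.inter_subset_left
  · rw [← Nat.cast_sum, sum_rowWeight, Nat.cast_sum, Finset.sum_apply]
    refine Finset.sum_congr rfl fun j _ => ?_
    rw [Finset.univ_inter, rankFunction_eq_card]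
    exact Matroid.isBasis'_iff_isBasis_inter_ground.2 (by simpa using (hC j).isBasis_ground)

theorem exists_isBase_sum_mul_le [Fintype α] (M : κ → Matroid α) {t : α → ℝ}
    (ht : t ∈ basePolytope (∑ j, rankFunction (M j))) (w : α → ℝ) :
    ∃ C : κ → Finset α, (∀ j, (M j).IsBase (C j : Set α)) ∧
      ∑ i, w i * t i ≤ ∑ i, w i * rowWeight C i := by
  classical
  have hchain : IsChain (· ⊆ ·) (Set.range fun c => {i | c ≤ w i}) :=
    (show Antitone fun c => {i | c ≤ w i} from fun c c' h i => h.trans).isChain_range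
  choose B hB hBC using fun j => exists_isBase_forall_isBasis'_inter (M j) hchain
  let C : κ → Finset α := fun j => (B j).toFinset
  have hC : ∀ j, (M j).IsBase (C j : Set α) := fun j => by rw [Set.coe_toFinset]; exact hB j
  have hlevel : ∀ c, ∑ i with c ≤ w i, (rowWeight C i : ℝ) =
      (∑ j, rankFunction (M j)) {i | c ≤ w i} := by
    intro c
    rw [← Nat.cast_sum, sum_rowWeight, Nat.cast_sum, Finset.sum_apply]
    refine Finset.sum_congr rfl fun j _ => (rankFunction_eq_card ?_).symm
    have := hBC j _ ⟨c, rfl⟩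
    simpa [C, Set.inter_comm] using this
  refine ⟨C, hC, ?_⟩
  have hd := sum_mul_nonneg_of_superlevel (w := w) (d := fun i => rowWeight C i - t i)
  simp only [Finset.sum_sub_distrib, mul_sub, sub_nonneg, sub_eq_zero] at hd
  exact hd (fun c => (ht.1 _).trans (hlevel c).ge)
    ((rowWeight_mem_basePolytope hC).2.trans ht.2.symm)

theorem convexHull_rowWeight_eq_basePolytope [Fintype α] (M : κ → Matroid α) :
    convexHull ℝ ((fun (C : κ → Finset α) i => (rowWeight C i : ℝ)) ''
      {C | ∀ j, (M j).IsBase (C j : Set α)}) = basePolytope (∑ j, rankFunction (M j)) := by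
  classical
  refine (convexHull_min ?_ (convex_basePolytope _)).antisymm fun t ht => ?_
  · rintro _ ⟨C, hC, rfl⟩
    exact rowWeight_mem_basePolytope hC
  · refine mem_convexHull_of_forall_exists_sum_mul_le ((Set.toFinite _).image _) fun w => ?_
    obtain ⟨C, hC, hle⟩ := exists_isBase_sum_mul_le M ht w
    exact ⟨_, ⟨C, hC, rfl⟩, hle⟩

end Matroid

section Submodular

variable {α : Type*} {z : Finset α → ℝ} {v : α → ℝ} {A : Finset α}

/-- `v` restricts to a point of the base polytope of the restriction of `z` to the subsets of `A`;
the values of `v` outside `A` are irrelevant. -/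
def IsBaseOn (z : Finset α → ℝ) (v : α → ℝ) (A : Finset α) : Prop :=
  (∀ J ⊆ A, ∑ i ∈ J, v i ≤ z J) ∧ ∑ i ∈ A, v i = z A

theorem isBaseOn_univ_iff [Fintype α] : IsBaseOn z v Finset.univ ↔ v ∈ basePolytope z := by
  simp only [IsBaseOn, Finset.subset_univ, forall_const, basePolytope, Set.mem_ofPred_eq]

theorem isBaseOn_empty (h0 : z ∅ = 0) (v : α → ℝ) : IsBaseOn z v ∅ := by
  simp [IsBaseOn, Finset.subset_empty, h0]

variable [DecidableEq α]

theorem IsBaseOn.update_insert (hz : ∀ I J, z (I ∪ J) + z (I ∩ J) ≤ z I + z J)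
    (hv : IsBaseOn z v A) {a : α} (ha : a ∉ A) :
    IsBaseOn z (Function.update v a (z (insert a A) - z A)) (insert a A) := by
  have hupdate : ∀ J : Finset α, a ∉ J →
      ∑ i ∈ J, Function.update v a (z (insert a A) - z A) i = ∑ i ∈ J, v i := fun J haJ =>
    Finset.sum_update_of_notMem haJ _ _
  constructor
  · intro J hJ
    by_cases haJ : a ∈ J
    · have hJA : J.erase a ⊆ A := Finset.subset_insert_iff.1 hJ
      have hunion : J ∪ A = insert a A := by grind
      have hinter : J ∩ A = J.erase a := by grind
      have hsub := hz J A
      rw [hunion, hinter] at hsub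
      rw [← Finset.add_sum_erase _ _ haJ, Function.update_self, hupdate _ (Finset.notMem_erase a J)]
      linarith [hv.1 _ hJA]
    · rw [hupdate J haJ]
      exact hv.1 J ((Finset.subset_insert_iff_of_notMem haJ).1 hJ)
  · rw [Finset.sum_insert ha, Function.update_self, hupdate A ha, hv.2, sub_add_cancel]

theorem IsBaseOn.exists_union (hz : ∀ I J, z (I ∪ J) + z (I ∩ J) ≤ z I + z J)
    (hv : IsBaseOn z v A) (s : Finset α) :
    ∃ u, IsBaseOn z u (A ∪ s) ∧ ∀ i ∈ A, u i = v i := by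
  induction s using Finset.induction_on with
  | empty => exact ⟨v, by rwa [Finset.union_empty], fun _ _ => rfl⟩
  | insert a s _ ih =>
    obtain ⟨u, hu, huv⟩ := ih
    rw [Finset.union_insert]
    by_cases ha : a ∈ A ∪ s
    · exact ⟨u, by rwa [Finset.insert_eq_of_mem ha], huv⟩
    · refine ⟨_, hu.update_insert hz ha, fun i hi => ?_⟩
      rw [Function.update_of_ne (by grind), huv i hi]

theorem exists_mem_basePolytope_sum_eq [Fintype α] (h0 : z ∅ = 0)
    (hz : ∀ I J, z (I ∪ J) + z (I ∩ J) ≤ z I + z J) (I : Finset α) :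
    ∃ v ∈ basePolytope z, ∑ i ∈ I, v i = z I := by
  obtain ⟨u, hu, -⟩ := (isBaseOn_empty h0 0).exists_union hz I
  rw [Finset.empty_union] at hu
  obtain ⟨v, hv, hvu⟩ := hu.exists_union hz Finset.univ
  rw [Finset.union_eq_right.2 (Finset.subset_univ I), isBaseOn_univ_iff] at hv
  exact ⟨v, hv, (Finset.sum_congr rfl hvu).trans hu.2⟩

end Submodular

section GeneralizedPermutahedra

variable {n : ℕ} {P : Set (Fin n → ℝ)} {z z' : Finset (Fin n) → ℝ}

theorem IsGeneralizedPermutahedronOf.eq_basePolytope (h : IsGeneralizedPermutahedronOf P z) :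
    P = basePolytope z :=
  h.2.2

theorem IsGeneralizedPermutahedronOf.le_of_subset (h : IsGeneralizedPermutahedronOf P z)
    (hP : P ⊆ basePolytope z') : z ≤ z' := by
  intro I
  obtain ⟨v, hv, hvI⟩ := exists_mem_basePolytope_sum_eq h.2.1 h.1 I
  exact hvI ▸ (hP (h.eq_basePolytope ▸ hv)).1 I

theorem IsGeneralizedPermutahedronOf.unique (h : IsGeneralizedPermutahedronOf P z)
    (h' : IsGeneralizedPermutahedronOf P z') : z = z' :=
  (h.le_of_subset h'.eq_basePolytope.le).antisymm (h'.le_of_subset h.eq_basePolytope.le)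

end GeneralizedPermutahedra

section SchubertMatroid

variable {n : ℕ} {I K B R S : Finset (Fin n)} {m x : Fin n}

/-- The number of elements of `I` from `t` on. Comparing these numbers for all `t` extends both
inclusion and the order `SetLE`. -/
def tailCard (I : Finset (Fin n)) (t : Fin n) : ℕ :=
  (I.filter (t ≤ ·)).card

theorem tailCard_mono : Monotone (tailCard (n := n)) := fun _ _ h _ =>
  Finset.card_le_card (Finset.filter_subset_filter _ h)

theorem setLE_refl (I : Finset (Fin n)) : SetLE I I :=
  ⟨rfl, fun _ => le_rfl⟩

theorem SetLE.tailCard_le (h : SetLE R S) : tailCard R ≤ tailCard S :=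
  ((setLE_iff R S).1 h).2

theorem tailCard_injective : (tailCard (n := n)).Injective := by
  intro I J h
  have hsplit : ∀ (A : Finset (Fin n)) t,
      tailCard A t = (A.filter (t < ·)).card + if t ∈ A then 1 else 0 := by
    intro A t
    split_ifs with ht
    · have hins : A.filter (t ≤ ·) = insert t (A.filter (t < ·)) := by grind
      rw [tailCard, hins, Finset.card_insert_of_notMem (by simp)]
    · rw [tailCard, add_zero]
      congr 1
      grind
  ext t
  induction t using WellFoundedGT.induction with
  | ind t ih =>
    have hlt : I.filter (t < ·) = J.filter (t < ·) := by grind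
    have ht := congrFun h t
    rw [hsplit, hsplit, hlt, Nat.add_left_cancel_iff] at ht
    split_ifs at ht <;> simp_all

theorem schubertMatroid_isBase_iff :
    (schubertMatroid n I).IsBase (B : Set (Fin n)) ↔ SetLE B I := by
  change (∃ A : Finset (Fin n), (A : Set (Fin n)) = B ∧ SetLE A I) ↔ _
  simp only [Finset.coe_inj, exists_eq_left]

theorem schubertRank_eq_rankFunction (I : Finset (Fin n)) :
    schubertRank I = rankFunction (schubertMatroid n I) := by
  ext J
  rw [schubertRank, rankFunction, ← matroidRank_eq_eRk _ J rfl, ENat.toNat_natCast]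

theorem SetLE.card_inter_le_schubertRank (hB : SetLE B I) (J : Finset (Fin n)) :
    ((J ∩ B).card : ℝ) ≤ schubertRank I J := by
  rw [schubertRank_eq_rankFunction]
  exact card_le_rankFunction ((schubertMatroid_isBase_iff.2 hB).indep.subset
    (Finset.coe_subset.2 Finset.inter_subset_right)) Finset.inter_subset_left

theorem exists_setLE_card_inter_eq_schubertRank (I J : Finset (Fin n)) :
    ∃ B, SetLE B I ∧ ((J ∩ B).card : ℝ) = schubertRank I J := by
  simpa only [schubertMatroid_isBase_iff, schubertRank_eq_rankFunction] using
    exists_isBase_card_inter_eq_rankFunction (schubertMatroid n I) J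

theorem SetLE.insert_erase (h : SetLE B I) (hm : m ∈ B) (hx : x ∉ B) (hxm : x ≤ m) :
    SetLE (insert x (B.erase m)) I := by
  have hxe : ∀ C ⊆ B, x ∉ C.erase m := fun C hC hc => hx (hC (Finset.mem_of_mem_erase hc))
  rw [setLE_iff] at h ⊢
  refine ⟨by rw [Finset.card_insert_of_notMem (hxe _ subset_rfl), Finset.card_erase_add_one hm,
    h.1], fun t => ?_⟩
  rw [Finset.filter_insert, Finset.filter_erase]
  split_ifs with htx
  · rw [Finset.card_insert_of_notMem (hxe _ (Finset.filter_subset _ _)),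
      Finset.card_erase_add_one (Finset.mem_filter.2 ⟨hm, htx.trans hxm⟩)]
    exact h.2 t
  · exact Finset.card_erase_le.trans (h.2 t)

/-- If a base of maximal intersection with `K ∪ {m}` missed some `x ∈ K` below `m`, trading `m`
for `x` would show that `m` does not increase the rank of `K`. -/
theorem exists_setLE_of_schubertRank_insert_ne
    (h : schubertRank I (insert m K) ≠ schubertRank I K) :
    ∃ B, SetLE B I ∧ m ∈ B ∧ ∀ x ∈ K, x < m → x ∈ B := by
  obtain ⟨B, hB, hBrank⟩ := exists_setLE_card_inter_eq_schubertRank I (insert m K)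
  have hmK : m ∉ K := fun hmK => h (by rw [Finset.insert_eq_of_mem hmK])
  have hlt : ∀ B', SetLE B' I → (K ∩ B').card < (insert m K ∩ B).card := by
    intro B' hB'
    have hmono : schubertRank I K ≤ schubertRank I (insert m K) := by
      rw [schubertRank_eq_rankFunction]
      exact rankFunction_mono _ (Finset.subset_insert m K)
    exact_mod_cast (hB'.card_inter_le_schubertRank K).trans_lt
      (hBrank ▸ lt_of_le_of_ne hmono h.symm)
  have hmB : m ∈ B := by
    by_contra hmB
    exact (hlt B hB).ne (by rw [Finset.insert_inter_of_notMem hmB])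
  refine ⟨B, hB, hmB, fun x hxK hxm => ?_⟩
  by_contra hxB
  refine (hlt _ (hB.insert_erase hmB hxB hxm.le)).ne ?_
  have hKB : K ∩ B.erase m = K ∩ B := by grind
  rw [Finset.inter_insert_of_mem hxK, hKB, Finset.insert_inter_of_mem hmB,
    Finset.card_insert_of_notMem (by simp [hxB]), Finset.card_insert_of_notMem (by simp [hmK])]

/-- The marginal value `f(K ∪ {m}) - f(K)`, where `m = max J` and `K = (J \ {m}) ∪ (m, n]`. On
Schubert ranks these functionals are triangular. -/
def maxMarginal (J : {J : Finset (Fin n) // J.Nonempty}) :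
    Module.Dual ℝ (Finset (Fin n) → ℝ) :=
  let m := J.1.max' J.2
  let K := J.1.erase m ∪ Finset.Ioi m
  LinearMap.proj (R := ℝ) (φ := fun _ : Finset (Fin n) => ℝ) (insert m K) - LinearMap.proj K

theorem tailCard_le_of_maxMarginal_ne_zero {J : {J : Finset (Fin n) // J.Nonempty}}
    (h : maxMarginal J (schubertRank I) ≠ 0) : tailCard J.1 ≤ tailCard I := by
  obtain ⟨B, hB, hmB, hKB⟩ := exists_setLE_of_schubertRank_insert_ne (sub_ne_zero.1 h)
  have hJB : J.1 ⊆ B := by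
    intro x hxJ
    by_cases hx : x = J.1.max' J.2
    · rwa [hx]
    · exact hKB x (by simp [hx, hxJ]) ((J.1.le_max' x hxJ).lt_of_ne hx)
  exact (tailCard_mono hJB).trans hB.tailCard_le

theorem maxMarginal_schubertRank_self_ne_zero (I : {I : Finset (Fin n) // I.Nonempty}) :
    maxMarginal I (schubertRank I.1) ≠ 0 := by
  obtain ⟨I, hI⟩ := I
  set m := I.max' hI
  have hmI : m ∈ I := I.max'_mem hI
  obtain ⟨B, hB, hrank⟩ :=
    exists_setLE_card_inter_eq_schubertRank I (I.erase m ∪ Finset.Ioi m)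
  have hBm : ∀ y ∈ B, y ≤ m := by
    intro y hyB
    by_contra! hmy
    have hyI : tailCard I y = 0 := Finset.card_eq_zero.2
      (Finset.filter_eq_empty_iff.2 fun i hi hyi => (hmy.trans_le hyi).not_ge (I.le_max' i hi))
    have hy : y ∈ B.filter (y ≤ ·) := Finset.mem_filter.2 ⟨hyB, le_rfl⟩
    exact (Finset.card_pos.2 ⟨y, hy⟩).ne' (Nat.le_zero.1 (hyI ▸ hB.tailCard_le y))
  have hsub : (I.erase m ∪ Finset.Ioi m) ∩ B ⊆ I.erase m := by
    intro y hy
    obtain ⟨hyK, hyB⟩ := Finset.mem_inter.1 hy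
    exact (Finset.mem_union.1 hyK).resolve_right fun h => (hBm y hyB).not_gt (Finset.mem_Ioi.1 h)
  have hlt : ((I.erase m ∪ Finset.Ioi m) ∩ B).card < I.card :=
    (Finset.card_le_card hsub).trans_lt (Finset.card_erase_lt_of_mem hmI)
  have hle := SetLE.card_inter_le_schubertRank (setLE_refl I) (insert m (I.erase m ∪ Finset.Ioi m))
  have hIK : I ⊆ insert m (I.erase m ∪ Finset.Ioi m) := by
    rw [← Finset.insert_union, Finset.insert_erase hmI]
    exact Finset.subset_union_left
  rw [Finset.inter_eq_right.2 hIK] at hle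
  exact sub_ne_zero.2 (hrank ▸ (Nat.cast_lt.2 hlt).trans_le hle).ne'

theorem linearIndependent_schubertRank :
    LinearIndependent ℝ fun I : {I : Finset (Fin n) // I.Nonempty} => schubertRank I.1 :=
  linearIndependent_of_triangular maxMarginal (p := fun I => tailCard I.1)
    (tailCard_injective.comp Subtype.val_injective) maxMarginal_schubertRank_self_ne_zero
    fun _ _ => tailCard_le_of_maxMarginal_ne_zero

theorem schubertRank_apply_empty (I : Finset (Fin n)) : schubertRank I ∅ = 0 := by
  rw [schubertRank_eq_rankFunction, rankFunction_empty]

theorem schubertRank_empty : schubertRank (∅ : Finset (Fin n)) = 0 := by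
  ext J
  obtain ⟨B, hB, hrank⟩ := exists_setLE_card_inter_eq_schubertRank ∅ J
  obtain rfl : B = ∅ := Finset.card_eq_zero.1 hB.fst
  simpa using hrank.symm

theorem finrank_pointedSetFunctions (n : ℕ) :
    Module.finrank ℝ (pointedSetFunctions n) =
      Fintype.card {I : Finset (Fin n) // I.Nonempty} := by
  let ev : Module.Dual ℝ (Finset (Fin n) → ℝ) := LinearMap.proj ∅
  have hker : pointedSetFunctions n = LinearMap.ker ev := rfl
  have hev : ev ≠ 0 := fun h => one_ne_zero (LinearMap.congr_fun h 1)
  have hrank := Module.Dual.finrank_ker_add_one_of_ne_zero hev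
  have hcard : Fintype.card {I : Finset (Fin n) // I.Nonempty} + 1 =
      Fintype.card (Finset (Fin n)) := by
    simp only [Finset.nonempty_iff_ne_empty]
    rw [Fintype.card_subtype_compl (· = ∅), Fintype.card_subtype_eq]
    exact Nat.sub_add_cancel Fintype.card_pos
  rw [Module.finrank_fintype_fun_eq_card] at hrank
  rw [hker]
  omega

theorem exists_basis_schubertRank (n : ℕ) :
    ∃ b : Module.Basis {I : Finset (Fin n) // I.Nonempty} ℝ (pointedSetFunctions n),
      ∀ I, (b I : Finset (Fin n) → ℝ) = schubertRank I.1 := by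
  let v : {I : Finset (Fin n) // I.Nonempty} → pointedSetFunctions n :=
    fun I => ⟨schubertRank I.1, schubertRank_apply_empty I.1⟩
  have hv : LinearIndependent ℝ v :=
    LinearIndependent.of_comp (pointedSetFunctions n).subtype linearIndependent_schubertRank
  have hspan := hv.span_eq_top_of_card_eq_finrank' (finrank_pointedSetFunctions n).symm
  exact ⟨Module.Basis.mk hv hspan.ge, fun I => by rw [Module.Basis.mk_apply]⟩

end SchubertMatroid

section DualCharacter

open MvPolynomial

variable {n k : ℕ} {C D : Diagram n k}

/-- The grading of `ℂ[𝔟]` by `ℕⁿ` in which `y_{ij}` has the degree of its row `i`. -/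
noncomputable def rowGrading (n : ℕ) (p : {p : Fin n × Fin n // p.1 ≤ p.2}) : Fin n →₀ ℕ :=
  Finsupp.single p.1.1 1

theorem genericUpper_isWeightedHomogeneous (i j : Fin n) :
    IsWeightedHomogeneous (rowGrading n) (genericUpper n i j) (Finsupp.single i 1) := by
  rw [genericUpper]
  split_ifs with h
  · exact isWeightedHomogeneous_X ℂ (rowGrading n) ⟨(i, j), h⟩
  · exact isWeightedHomogeneous_zero ℂ _ _

theorem upperMinor_isWeightedHomogeneous (R S : Finset (Fin n)) (h : S.card = R.card) :
    IsWeightedHomogeneous (rowGrading n) (upperMinor R S h) (∑ i ∈ S, Finsupp.single i 1) := by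
  have hS : ∑ i ∈ S, Finsupp.single i (1 : ℕ) = ∑ m, Finsupp.single (S.orderEmbOfFin h m) 1 := by
    conv_lhs => rw [← Finset.map_orderEmbOfFin_univ S h]
    rw [Finset.sum_map]
    rfl
  rw [upperMinor, Matrix.det_apply, ← mem_weightedHomogeneousSubmodule]
  refine Submodule.sum_mem _ fun σ _ => ?_
  rw [Units.smul_def, ← Int.cast_smul_eq_zsmul ℂ]
  refine Submodule.smul_mem _ _ ?_
  rw [mem_weightedHomogeneousSubmodule, hS, ← Equiv.sum_comp σ]
  exact IsWeightedHomogeneous.prod _ _ _ fun m _ => genericUpper_isWeightedHomogeneous _ _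

theorem minorProduct_isWeightedHomogeneous (h : DiagramLE C D) :
    IsWeightedHomogeneous (rowGrading n) (minorProduct C D h) (rowWeight C) :=
  IsWeightedHomogeneous.prod _ _ _ fun _ _ => upperMinor_isWeightedHomogeneous _ _ _

theorem upperMinor_ne_zero {R S : Finset (Fin n)} (h : SetLE S R) :
    upperMinor R S h.fst ≠ 0 := by
  classical
  -- Since `s_m ≤ r_m`, an upper triangular matrix may have `1` at each `(s_m, r_m)` and `0`
  -- elsewhere.
  let v : {p : Fin n × Fin n // p.1 ≤ p.2} → ℂ := fun p =>
    if ∃ m, p.1 = (S.orderEmbOfFin h.fst m, R.orderEmbOfFin rfl m) then 1 else 0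
  have hone : eval v (upperMinor R S h.fst) = 1 := by
    rw [upperMinor, RingHom.map_det, ← Matrix.det_one (n := Fin R.card)]
    congr 1
    ext a b
    rw [Matrix.one_apply, RingHom.mapMatrix_apply, Matrix.map_apply, Matrix.submatrix_apply,
      genericUpper]
    split_ifs with hle hab hab
    · subst hab
      rw [eval_X]
      exact if_pos ⟨a, rfl⟩
    · rw [eval_X]
      refine if_neg ?_
      rintro ⟨m, hm⟩
      rw [Prod.mk.injEq, EmbeddingLike.apply_eq_iff_eq, EmbeddingLike.apply_eq_iff_eq] at hm
      exact hab (hm.1.trans hm.2.symm)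
    · exact absurd (hab ▸ h.snd a) hle
    · rw [map_zero]
  intro hzero
  rw [hzero, map_zero] at hone
  exact zero_ne_one hone

theorem minorProduct_ne_zero (h : DiagramLE C D) : minorProduct C D h ≠ 0 :=
  Finset.prod_ne_zero_iff.2 fun j _ => upperMinor_ne_zero (h j)

theorem exists_weight_eq_of_mem_span {R M σ ι : Type*} [CommSemiring R] [AddCommMonoid M]
    {w : σ → M} {f : MvPolynomial σ R} {m : M} (hf : IsWeightedHomogeneous w f m) (hf0 : f ≠ 0)
    {g : ι → MvPolynomial σ R} {d : ι → M} (hg : ∀ v, IsWeightedHomogeneous w (g v) (d v))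
    (hspan : f ∈ Submodule.span R (Set.range g)) : ∃ v, d v = m := by
  classical
  by_contra! hd
  have hker : Submodule.span R (Set.range g) ≤
      LinearMap.ker (weightedHomogeneousComponent (R := R) w m) := by
    rw [Submodule.span_le, Set.range_subset_iff]
    exact fun v => (hg v).weightedHomogeneousComponent_ne m (hd v).symm
  exact hf0 (hf.weightedHomogeneousComponent_same.symm.trans (hker hspan))

theorem exists_basis_minorProduct (D : Diagram n k) :
    ∃ (ι : Type) (_ : Fintype ι) (B : Module.Basis ι ℂ (flaggedWeylModule D))
      (C : ι → Diagram n k) (h : ∀ v, DiagramLE (C v) D),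
      ∀ v, (B v : BorelRing n) = minorProduct (C v) D (h v) := by
  classical
  let g : {C : Diagram n k // DiagramLE C D} → BorelRing n := fun C => minorProduct C.1 D C.2
  obtain ⟨ι, a, ha, hspan, hli⟩ := exists_linearIndependent' ℂ g
  have hM : Submodule.span ℂ (Set.range (g ∘ a)) = flaggedWeylModule D := by
    rw [hspan, flaggedWeylModule]
    congr 1
    ext f
    simp only [Set.mem_range, Subtype.exists, Set.mem_ofPred_eq, eq_comm, g]
  exact ⟨ι, @Fintype.ofFinite _ (Finite.of_injective a ha),
    (Module.Basis.span hli).map (LinearEquiv.ofEq _ _ hM), fun v => (a v).1, fun v => (a v).2,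
    fun v => by simp [Module.Basis.span_apply, g]⟩

/-- The torus acts diagonally on a basis of minor products, so its trace is a sum of monomials. -/
theorem dualCharacterPoly_eq_sum_monomial {ι : Type*} [Fintype ι]
    (B : Module.Basis ι ℂ (flaggedWeylModule D)) {C : ι → Diagram n k}
    {h : ∀ v, DiagramLE (C v) D} (hB : ∀ v, (B v : BorelRing n) = minorProduct (C v) D (h v)) :
    dualCharacterPoly D = ∑ v, monomial (rowWeight (C v)) 1 := by
  classical
  refine (dualCharacterPoly_unique D _ fun x => ?_).symm
  have hact : ∀ v, (borelAct (torusElt x⁻¹)).toLinearMap.restrict (flaggedWeylModule_stable D x)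
      (B v) = (∏ j, ∏ i ∈ C v j, (x i : ℂ)) • B v := by
    intro v
    apply Subtype.ext
    rw [LinearMap.coe_restrict_apply, AlgHom.toLinearMap_apply, Submodule.coe_smul, hB,
      minorProduct_act]
  rw [dualCharacter, LinearMap.trace_eq_matrix_trace ℂ B, Matrix.trace, map_sum]
  refine Finset.sum_congr rfl fun v _ => ?_
  have hdiag : (LinearMap.toMatrix B B ((borelAct (torusElt x⁻¹)).toLinearMap.restrict
      (flaggedWeylModule_stable D x))).diag v = ∏ j, ∏ i ∈ C v j, (x i : ℂ) := by
    rw [Matrix.diag_apply, LinearMap.toMatrix_apply, hact]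
    simp
  rw [hdiag, rowWeight, monomial_sum_one]
  simp only [monomial_sum_one, map_prod, aeval_monomial, map_one, one_mul, pow_one,
    Finsupp.prod_single_index, pow_zero]

theorem mem_support_dualCharacterPoly {α : Fin n →₀ ℕ} :
    α ∈ (dualCharacterPoly D).support ↔ ∃ C, DiagramLE C D ∧ rowWeight C = α := by
  classical
  obtain ⟨ι, _, B, C, h, hB⟩ := exists_basis_minorProduct D
  have hcoeff : (dualCharacterPoly D).coeff α =
      ((Finset.univ.filter fun v => rowWeight (C v) = α).card : ℤ) := by
    rw [dualCharacterPoly_eq_sum_monomial B hB, coeff_sum]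
    simp only [coeff_monomial, Finset.sum_boole]
  rw [mem_support_iff, hcoeff, Nat.cast_ne_zero, Finset.card_ne_zero, Finset.filter_nonempty_iff]
  constructor
  · rintro ⟨v, -, hv⟩
    exact ⟨C v, h v, hv⟩
  · rintro ⟨E, hE, rfl⟩
    have hspan : minorProduct E D hE ∈
        Submodule.span ℂ (Set.range fun v => (B v : BorelRing n)) := by
      have hmem := Submodule.mem_map_of_mem (f := (flaggedWeylModule D).subtype)
        (B.mem_span ⟨minorProduct E D hE, Submodule.subset_span ⟨E, hE, rfl⟩⟩)
      rwa [Submodule.map_span, ← Set.range_comp] at hmem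
    obtain ⟨v, hv⟩ := exists_weight_eq_of_mem_span (minorProduct_isWeightedHomogeneous hE)
      (minorProduct_ne_zero hE)
      (fun v => by rw [hB]; exact minorProduct_isWeightedHomogeneous (h v)) hspan
    exact ⟨v, Finset.mem_univ v, hv⟩

end DualCharacter

section Schubitope

variable {n k k' : ℕ}

/-- The sum of the rank functions of the Schubert matroids of the columns of `D`, which turns out
to be the submodular function of the Schubitope of `D`. -/
noncomputable def diagramRank (D : Diagram n k) : Finset (Fin n) → ℝ :=
  ∑ j, schubertRank (D j)

theorem schubitope_eq_convexHull_rowWeight (D : Diagram n k) :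
    schubitope D =
      convexHull ℝ ((fun (C : Diagram n k) i => (rowWeight C i : ℝ)) '' {C | DiagramLE C D}) := by
  have hsupport : ((dualCharacterPoly D).support : Set (Fin n →₀ ℕ)) =
      rowWeight '' {C | DiagramLE C D} :=
    Set.ext fun _ => mem_support_dualCharacterPoly
  rw [schubitope, newtonPolytope, hsupport, Set.image_image]

theorem schubitope_eq_basePolytope (D : Diagram n k) :
    schubitope D = basePolytope (diagramRank D) := by
  have hrank : diagramRank D = ∑ j, rankFunction (schubertMatroid n (D j)) :=
    Finset.sum_congr rfl fun j _ => schubertRank_eq_rankFunction (D j)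
  rw [hrank, ← convexHull_rowWeight_eq_basePolytope, schubitope_eq_convexHull_rowWeight]
  simp only [schubertMatroid_isBase_iff, DiagramLE]

theorem isGeneralizedPermutahedronOf_schubitope (D : Diagram n k) :
    IsGeneralizedPermutahedronOf (schubitope D) (diagramRank D) := by
  refine ⟨fun I J => ?_, ?_, schubitope_eq_basePolytope D⟩
  · simp only [diagramRank, Finset.sum_apply, ← Finset.sum_add_distrib]
    refine Finset.sum_le_sum fun j _ => ?_
    rw [schubertRank_eq_rankFunction]
    exact rankFunction_submodular _ I J
  · simp only [diagramRank, Finset.sum_apply, schubertRank_apply_empty, Finset.sum_const_zero]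

theorem schubitope_eq_iff_diagramRank_eq {D : Diagram n k} {D' : Diagram n k'} :
    schubitope D = schubitope D' ↔ diagramRank D = diagramRank D' := by
  refine ⟨fun h => ?_, fun h => by rw [schubitope_eq_basePolytope, schubitope_eq_basePolytope, h]⟩
  exact (h ▸ isGeneralizedPermutahedronOf_schubitope D).unique
    (isGeneralizedPermutahedronOf_schubitope D')

/-- The nonempty columns of `D`, as indices of the basis of Schubert rank functions. -/
def nonemptyColumn (D : Diagram n k) (j : {j // (D j).Nonempty}) :
    {I : Finset (Fin n) // I.Nonempty} :=
  ⟨D j.1, j.2⟩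

theorem diagramRank_eq_sum_nonemptyColumn (D : Diagram n k) :
    diagramRank D = ∑ j, schubertRank (nonemptyColumn D j).1 := by
  have hempty : ∀ j, schubertRank (D j) ≠ 0 → (D j).Nonempty := fun j hj =>
    Finset.nonempty_iff_ne_empty.2 fun hDj => hj (hDj ▸ schubertRank_empty)
  rw [diagramRank, ← Finset.sum_filter_of_ne fun j _ => hempty j]
  exact Finset.sum_subtype _ (by simp) fun j => schubertRank (D j)

theorem schubitope_eq_iff (D : Diagram n k) (D' : Diagram n k') :
    schubitope D = schubitope D' ↔
      ∃ e : {j // (D j).Nonempty} ≃ {j // (D' j).Nonempty}, ∀ j, D j.1 = D' (e j).1 := by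
  rw [schubitope_eq_iff_diagramRank_eq, diagramRank_eq_sum_nonemptyColumn,
    diagramRank_eq_sum_nonemptyColumn,
    sum_comp_eq_sum_comp_iff_exists_equiv linearIndependent_schubertRank]
  simp only [nonemptyColumn, Subtype.mk.injEq]

theorem exists_perm_iff_exists_equiv_nonempty {ι α : Type*} [Finite ι] (D D' : ι → Finset α) :
    (∃ σ : Equiv.Perm ι, ∀ j, D j = D' (σ j)) ↔
      ∃ e : {j // (D j).Nonempty} ≃ {j // (D' j).Nonempty}, ∀ j, D j.1 = D' (e j).1 := by
  classical
  constructor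
  · rintro ⟨σ, hσ⟩
    exact ⟨σ.subtypeEquiv fun j => by rw [hσ], fun j => hσ j.1⟩
  · rintro ⟨e, he⟩
    refine ⟨e.extendSubtype, fun j => ?_⟩
    by_cases hj : (D j).Nonempty
    · rw [e.extendSubtype_apply_of_mem j hj]
      exact he ⟨j, hj⟩
    · rw [Finset.not_nonempty_iff_eq_empty.1 hj,
        Finset.not_nonempty_iff_eq_empty.1 (e.extendSubtype_not_mem j hj)]

theorem exists_diagramRank_eq_iff {z : Finset (Fin n) → ℝ} :
    (∃ (k : ℕ) (D : Diagram n k), z = diagramRank D) ↔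
      ∃ c : {I : Finset (Fin n) // I.Nonempty} → ℕ, z = ∑ I, c I • schubertRank I.1 := by
  classical
  constructor
  · rintro ⟨k, D, rfl⟩
    refine ⟨fun I => Fintype.card {j // nonemptyColumn D j = I}, ?_⟩
    rw [diagramRank_eq_sum_nonemptyColumn,
      ← Fintype.sum_fiberwise' (nonemptyColumn D) fun I => schubertRank I.1]
    simp only [Finset.sum_const, Finset.card_univ]
  · rintro ⟨c, rfl⟩
    let e := Fintype.equivFin (Σ I : {I : Finset (Fin n) // I.Nonempty}, Fin (c I))
    refine ⟨_, fun j => (e.symm j).1.1, ?_⟩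
    rw [diagramRank, Equiv.sum_comp e.symm fun x => schubertRank x.1.1, Fintype.sum_sigma]
    simp only [Finset.sum_const, Finset.card_univ, Fintype.card_fin]

theorem IsGeneralizedPermutahedronOf.isSchubitope_iff {P : Set (Fin n → ℝ)}
    {z : Finset (Fin n) → ℝ} (h : IsGeneralizedPermutahedronOf P z) :
    IsSchubitope P ↔ ∃ (k : ℕ) (D : Diagram n k), z = diagramRank D := by
  constructor
  · rintro ⟨k, D, rfl⟩
    exact ⟨k, D, h.unique (isGeneralizedPermutahedronOf_schubitope D)⟩
  · rintro ⟨k, D, rfl⟩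
    exact ⟨k, D, h.eq_basePolytope.trans (schubitope_eq_basePolytope D).symm⟩

end Schubitope

end SchubitopeTheory

theorem theorem1p4 (n : ℕ) (hn : 1 ≤ n) :
    -- the rank functions, indexed by the nonempty subsets of `[n]`, form a basis
    (∃ b : Module.Basis {I : Finset (Fin n) // I.Nonempty} ℝ (pointedSetFunctions n),
      ∀ I, (b I : Finset (Fin n) → ℝ) = schubertRank I.1) ∧
    -- Schubitopes among generalized permutahedra
    (∀ (P : Set (Fin n → ℝ)) (z : Finset (Fin n) → ℝ), IsGeneralizedPermutahedronOf P z →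
      (IsSchubitope P ↔
        ∃ c : {I : Finset (Fin n) // I.Nonempty} → ℕ, z = ∑ I, c I • schubertRank I.1)) ∧
    -- equality of Schubitopes of diagrams in the same grid
    (∀ (k : ℕ) (D D' : Diagram n k),
      schubitope D = schubitope D' ↔ ∃ σ : Equiv.Perm (Fin k), ∀ j, D j = D' (σ j)) ∧
    -- equality of Schubitopes of diagrams in grids of different widths, up to empty columns
    (∀ (k k' : ℕ) (D : Diagram n k) (D' : Diagram n k'),
      schubitope D = schubitope D' ↔
        ∃ e : {j // (D j).Nonempty} ≃ {j // (D' j).Nonempty}, ∀ j, D j.1 = D' (e j).1) := by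
  exact ⟨exists_basis_schubertRank n,
    fun _ _ h => h.isSchubitope_iff.trans exists_diagramRank_eq_iff,
    fun _ D D' => (schubitope_eq_iff D D').trans (exists_perm_iff_exists_equiv_nonempty D D').symm,
    fun _ _ D D' => schubitope_eq_iff D D'⟩
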